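/- Let $(\bar M,\bar g)$ be a semi-Riemannian manifold with Levi-Civita connection $\bar\nabla$, and let $\bar J$ be a smooth $(1,1)$-tensor field with $\bar J^2=3\bar J+I$, $\bar g(\bar JX,Y)=\bar g(X,\bar JY)$ and $\bar\nabla\bar J=0$ (a locally bronze semi-Riemannian manifold). Let $l,m$ be smooth functions on $\bar M$, not both identically zero, let $\eta$ be a smooth vector field with $\bar g(\eta,\eta)=1$, put $\theta(Y)=\bar g(Y,\eta)$, and let $$\bar\Omega_XY=\bar\nabla_XY+\theta(Y)\{lX+m\bar JX\}$$ be the corresponding $(l,m)$-type connection. Let $M$ be a lightlike (immersed) submanifold of $\bar M$: $\mathrm{Rad}(TM)=TM\cap TM^{\perp}$ is a smooth distribution of constant rank $r>0$. Let $S(TM)$ and $S(TM^\perp)$ be smooth complements of $\mathrm{Rad}(TM)$ in $TM$ and in $TM^\perp$, and let $\mathrm{ltr}(TM)$ be a lightlike transversal bundle, i.e. a smooth totally null subbundle orthogonal to $S(TM)$ and $S(TM^\perp)$ with $T\bar M|_M=TM\oplus \mathrm{ltr}(TM)\oplus S(TM^\perp)$. Assume that $M$ is screen generic: * $\bar J(\mathrm{Rad}(TM))=\mathrm{Rad}(TM)$;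 * $B_o:=\bar J(S(TM))\cap S(TM)$ is a smooth nondegenerate distribution; * with $B'$ the orthogonal complement of $B_o$ in $S(TM)$, for each $Z\in\Gamma(B')$ one has $\bar JZ=fZ+wZ$ with $fZ\in\Gamma(B')$ and $wZ\in\Gamma(S(TM^\perp))$. For $X\in\Gamma(TM)$ and $Y\in\Gamma(S(TM))$ decompose $\bar\Omega_XY=\Omega_XY+\bar h^l(X,Y)+\bar h^s(X,Y)$ with $\Omega_XY\in\Gamma(TM)$, $\bar h^l(X,Y)\in\Gamma(\mathrm{ltr}(TM))$, $\bar h^s(X,Y)\in\Gamma(S(TM^\perp))$, and $\Omega_XY=\Omega^*_XY+\bar h^*(X,Y)$ with $\Omega^*_XY\in\Gamma(S(TM))$, $\bar h^*(X,Y)\in\Gamma(\mathrm{Rad}(TM))$. Then $B_o$ is parallel with respect to the induced connection $\Omega$ (i.e. $\Omega_XY\in\Gamma(B_o)$ for all $X,Y\in\Gamma(B_o)$) if and only if, for all $X,Y\in\Gamma(B_o)$, $Z\in\Gamma(B')$ and $N\in\Gamma(\mathrm{ltr}(TM))$, 1. $\bar g(\bar h^*(X,\bar JY),\bar JN)=3\,\bar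 g(\bar h^*(X,\bar JY),N)$, and 2. $\bar g(\Omega^*_X\bar JY,fZ)+\bar g(\bar h^s(X,\bar JY),\bar JZ)=3\,\bar g(\Omega^*_X\bar JY,Z)$. -/

import Mathlib

open Bundle Topology
open scoped Manifold ContDiff

noncomputable section

namespace LightlikeGeometry

section Ambient

variable (E : Type*) [NormedAddCommGroup E] [NormedSpace ℝ E]
  (Mb : Type*) [TopologicalSpace Mb] [ChartedSpace E Mb] [IsManifold 𝓘(ℝ, E) ∞ Mb]

/-- A smooth semi-Riemannian metric: a smooth, symmetric, nondegenerate `(0,2)`-tensor field of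
constant index (the index at a point is the largest dimension of a negative definite subspace). -/
structure SemiRiemannianMetric where
  inner : ∀ x : Mb, TangentSpace 𝓘(ℝ, E) x →L[ℝ] TangentSpace 𝓘(ℝ, E) x →L[ℝ] ℝ
  symm : ∀ (x : Mb) (v w : TangentSpace 𝓘(ℝ, E) x), inner x v w = inner x w v
  nondegenerate : ∀ (x : Mb) (v : TangentSpace 𝓘(ℝ, E) x), (∀ w, inner x v w = 0) → v = 0
  index_const : ∃ q : ℕ, ∀ x : Mb, IsGreatest
    {k : ℕ | ∃ W : Submodule ℝ (TangentSpace 𝓘(ℝ, E) x),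
      Module.finrank ℝ W = k ∧ ∀ w ∈ W, w ≠ 0 → inner x w w < 0} q
  contMDiff : ContMDiff 𝓘(ℝ, E) (𝓘(ℝ, E).prod 𝓘(ℝ, E →L[ℝ] E →L[ℝ] ℝ)) ∞
    (fun x ↦ TotalSpace.mk' (E →L[ℝ] E →L[ℝ] ℝ)
      (E := fun x : Mb ↦ TangentSpace 𝓘(ℝ, E) x →L[ℝ] TangentSpace 𝓘(ℝ, E) x →L[ℝ] ℝ)
      x (inner x))

variable {E Mb}

/-- The subspace of `T_x` orthogonal to `W`. -/
def SemiRiemannianMetric.perp (g : SemiRiemannianMetric E Mb) (x : Mb)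
    (W : Submodule ℝ (TangentSpace 𝓘(ℝ, E) x)) : Submodule ℝ (TangentSpace 𝓘(ℝ, E) x) where
  carrier := {v | ∀ w ∈ W, g.inner x v w = 0}
  zero_mem' := by intro w _; simp
  add_mem' := by
    intro a b ha hb w hw
    simp [ha w hw, hb w hw]
  smul_mem' := by
    intro c a ha w hw
    simp [ha w hw]

/-- A bronze structure compatible with `g`: a smooth `(1,1)`-tensor field `J` with `J² = 3J + I`
which is self-adjoint for `g`. -/
structure BronzeStructure (g : SemiRiemannianMetric E Mb) where
  J : ∀ x : Mb, TangentSpace 𝓘(ℝ, E) x →L[ℝ] TangentSpace 𝓘(ℝ, E) x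
  contMDiff : ContMDiff 𝓘(ℝ, E) (𝓘(ℝ, E).prod 𝓘(ℝ, E →L[ℝ] E)) ∞
    (fun x ↦ TotalSpace.mk' (E →L[ℝ] E)
      (E := fun x : Mb ↦ TangentSpace 𝓘(ℝ, E) x →L[ℝ] TangentSpace 𝓘(ℝ, E) x) x (J x))
  sq : ∀ (x : Mb) (v : TangentSpace 𝓘(ℝ, E) x), J x (J x v) = (3 : ℝ) • J x v + v
  compatible : ∀ (x : Mb) (v w : TangentSpace 𝓘(ℝ, E) x),
    g.inner x v (J x w) = g.inner x (J x v) w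

/-- `cov` is the Levi-Civita connection of `g`: torsion-free and metric.
Here `cov Y x v` is `(∇_v Y)(x)`. -/
structure IsLeviCivita (g : SemiRiemannianMetric E Mb)
    (cov : CovariantDerivative 𝓘(ℝ, E) E (TangentSpace 𝓘(ℝ, E) : Mb → Type _)) : Prop where
  torsion_free : ∀ (X Y : ∀ x : Mb, TangentSpace 𝓘(ℝ, E) x) (x : Mb),
    MDiffAt (T% X) x → MDiffAt (T% Y) x →
      cov Y x (X x) - cov X x (Y x) = VectorField.mlieBracket 𝓘(ℝ, E) X Y x
  metric : ∀ (Y Z : ∀ x : Mb, TangentSpace 𝓘(ℝ, E) x) (x : Mb) (v : TangentSpace 𝓘(ℝ, E) x),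
    MDiffAt (T% Y) x → MDiffAt (T% Z) x →
      mfderiv 𝓘(ℝ, E) 𝓘(ℝ, ℝ) (fun y ↦ g.inner y (Y y) (Z y)) x v
        = g.inner x (cov Y x v) (Z x) + g.inner x (Y x) (cov Z x v)

/-- `∇J = 0`. Together with `IsLeviCivita` this is the locally bronze condition. -/
def BronzeStructure.IsParallel {g : SemiRiemannianMetric E Mb} (J : BronzeStructure g)
    (cov : CovariantDerivative 𝓘(ℝ, E) E (TangentSpace 𝓘(ℝ, E) : Mb → Type _)) : Prop :=
  ∀ (Y : ∀ x : Mb, TangentSpace 𝓘(ℝ, E) x) (x : Mb) (v : TangentSpace 𝓘(ℝ, E) x),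
    MDiffAt (T% Y) x → cov (fun y ↦ J.J y (Y y)) x v = J.J x (cov Y x v)

/-- The data of an `(l,m)`-type connection: smooth functions `l`, `m`, not both identically zero,
and a smooth unit spacelike vector field `η`. -/
structure LMData (g : SemiRiemannianMetric E Mb) where
  l : Mb → ℝ
  m : Mb → ℝ
  η : ∀ x : Mb, TangentSpace 𝓘(ℝ, E) x
  l_smooth : ContMDiff 𝓘(ℝ, E) 𝓘(ℝ, ℝ) ∞ l
  m_smooth : ContMDiff 𝓘(ℝ, E) 𝓘(ℝ, ℝ) ∞ m
  η_smooth : ContMDiff 𝓘(ℝ, E) 𝓘(ℝ, E).tangent ∞ (T% η)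
  η_unit : ∀ x, g.inner x (η x) (η x) = 1
  ne_zero : ¬ (l = 0 ∧ m = 0)

/-- The `(l,m)`-type connection `Ω_X Y = ∇_X Y + θ(Y) (l X + m J X)`, `θ = g(η, ·)`. -/
def lmConnection {g : SemiRiemannianMetric E Mb} (J : BronzeStructure g) (D : LMData g)
    (cov : CovariantDerivative 𝓘(ℝ, E) E (TangentSpace 𝓘(ℝ, E) : Mb → Type _)) :
    CovariantDerivative 𝓘(ℝ, E) E (TangentSpace 𝓘(ℝ, E) : Mb → Type _) :=
  cov.addOneForm fun x ↦
    (g.inner x (D.η x)).smulRight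
      (D.l x • ContinuousLinearMap.id ℝ (TangentSpace 𝓘(ℝ, E) x) + D.m x • J.J x)

end Ambient

section Submanifold

variable {E : Type*} [NormedAddCommGroup E] [NormedSpace ℝ E]
  {Mb : Type*} [TopologicalSpace Mb] [ChartedSpace E Mb] [IsManifold 𝓘(ℝ, E) ∞ Mb]
  {E' : Type*} [NormedAddCommGroup E'] [NormedSpace ℝ E']
  {M : Type*} [TopologicalSpace M] [ChartedSpace E' M] [IsManifold 𝓘(ℝ, E') ∞ M]

/-- A smooth section of `ι^* T Mb` with values in the family of subspaces `D`,
i.e. an element of `Γ(D)`. -/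
structure IsSection (ι : M → Mb) (D : ∀ p : M, Submodule ℝ (TangentSpace 𝓘(ℝ, E) (ι p)))
    (V : ∀ p : M, TangentSpace 𝓘(ℝ, E) (ι p)) : Prop where
  smooth : ContMDiff 𝓘(ℝ, E') 𝓘(ℝ, E).tangent ∞
    (fun p ↦ (⟨ι p, V p⟩ : TangentBundle 𝓘(ℝ, E) Mb))
  mem : ∀ p, V p ∈ D p

/-- A smooth vector field `X` on `M` that is a section of `D ⊆ ι^* T Mb` after the usual
identification of `T_p M` with its image under the differential of the immersion `ι`. -/
structure IsFieldIn (ι : M → Mb) (D : ∀ p : M, Submodule ℝ (TangentSpace 𝓘(ℝ, E) (ι p)))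
    (X : ∀ p : M, TangentSpace 𝓘(ℝ, E') p) : Prop where
  smooth : ContMDiff 𝓘(ℝ, E') 𝓘(ℝ, E').tangent ∞ (T% X)
  mem : ∀ p, mfderiv 𝓘(ℝ, E') 𝓘(ℝ, E) ι p (X p) ∈ D p

/-- `D` is a smooth vector subbundle of `ι^* T Mb`: it is locally spanned by a smooth frame. -/
def IsSmoothSubbundle (ι : M → Mb) (D : ∀ p : M, Submodule ℝ (TangentSpace 𝓘(ℝ, E) (ι p))) :
    Prop :=
  ∀ p : M, ∃ (U : Set M) (k : ℕ) (s : Fin k → ∀ q : M, TangentSpace 𝓘(ℝ, E) (ι q)),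
    IsOpen U ∧ p ∈ U ∧
    (∀ i, ContMDiffOn 𝓘(ℝ, E') 𝓘(ℝ, E).tangent ∞
      (fun q ↦ (⟨ι q, s i q⟩ : TangentBundle 𝓘(ℝ, E) Mb)) U) ∧
    ∀ q ∈ U, LinearIndependent ℝ (fun i ↦ s i q) ∧
      Submodule.span ℝ (Set.range fun i ↦ s i q) = D q

/-- The pull-back of the connection `cov` to `ι^* T Mb`; this is the meaning of `∇_v V` for `v`
tangent to `M` and `V` a vector field along `ι`. In the trivialization `e` of `T Mb` around `ι p`,
write `V` as a coefficient vector `c`; then `∇_v V = dc(v) + ∇_{dι v} (c(p))`, where the constant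
coefficient vector `c(p)` is regarded as a local vector field on `Mb` by means of `e`. -/
def pullbackCov (cov : CovariantDerivative 𝓘(ℝ, E) E (TangentSpace 𝓘(ℝ, E) : Mb → Type _))
    (ι : M → Mb) (V : ∀ p : M, TangentSpace 𝓘(ℝ, E) (ι p)) (p : M)
    (v : TangentSpace 𝓘(ℝ, E') p) : TangentSpace 𝓘(ℝ, E) (ι p) :=
  let e := trivializationAt E (TangentSpace 𝓘(ℝ, E) : Mb → Type _) (ι p)
  let c : M → E := fun q ↦ (e ⟨ι q, V q⟩).2
  e.symm (ι p) (mfderiv 𝓘(ℝ, E') 𝓘(ℝ, E) c p v)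
    + cov (fun y ↦ e.symm y (c p)) (ι p) (mfderiv 𝓘(ℝ, E') 𝓘(ℝ, E) ι p v)

/-- The tangent space of `M`, as a subspace of the tangent space of `Mb`. -/
def tangentImage (E' : Type*) [NormedAddCommGroup E'] [NormedSpace ℝ E']
    {M : Type*} [TopologicalSpace M] [ChartedSpace E' M]
    (ι : M → Mb) (p : M) : Submodule ℝ (TangentSpace 𝓘(ℝ, E) (ι p)) :=
  LinearMap.range (mfderiv 𝓘(ℝ, E') 𝓘(ℝ, E) ι p).toLinearMap

/-- `Rad TM = TM ∩ TM^⊥`. -/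
def radical (E' : Type*) [NormedAddCommGroup E'] [NormedSpace ℝ E']
    {M : Type*} [TopologicalSpace M] [ChartedSpace E' M]
    (g : SemiRiemannianMetric E Mb) (ι : M → Mb) (p : M) :
    Submodule ℝ (TangentSpace 𝓘(ℝ, E) (ι p)) :=
  tangentImage E' ι p ⊓ g.perp (ι p) (tangentImage E' ι p)

/-- A lightlike submanifold `(M, g, S(TM), S(TM^⊥))` together with its lightlike transversal
bundle `ltr(TM)`: the immersion `ι` has a radical of constant positive rank, `screen = S(TM)` and
`str = S(TM^⊥)` are complements of the radical in `TM` and `TM^⊥`, and `ltr` is a null bundle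
orthogonal to both, such that `tr(TM) = ltr ⊕ str` is a complement of `TM`. -/
structure LightlikeSubmanifold (E' : Type*) [NormedAddCommGroup E'] [NormedSpace ℝ E']
    {M : Type*} [TopologicalSpace M] [ChartedSpace E' M] [IsManifold 𝓘(ℝ, E') ∞ M]
    (g : SemiRiemannianMetric E Mb) (ι : M → Mb) where
  immersion : Manifold.IsImmersion 𝓘(ℝ, E') 𝓘(ℝ, E) ∞ ι
  rad_smooth : IsSmoothSubbundle (E' := E') ι (radical E' g ι)
  rad_rank : ∃ r : ℕ, 0 < r ∧ ∀ p, Module.finrank ℝ (radical E' g ι p) = r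
  screen : ∀ p : M, Submodule ℝ (TangentSpace 𝓘(ℝ, E) (ι p))
  screen_smooth : IsSmoothSubbundle (E' := E') ι screen
  rad_disjoint_screen : ∀ p, Disjoint (radical E' g ι p) (screen p)
  rad_sup_screen : ∀ p, radical E' g ι p ⊔ screen p = tangentImage E' ι p
  str : ∀ p : M, Submodule ℝ (TangentSpace 𝓘(ℝ, E) (ι p))
  str_smooth : IsSmoothSubbundle (E' := E') ι str
  rad_disjoint_str : ∀ p, Disjoint (radical E' g ι p) (str p)
  rad_sup_str : ∀ p, radical E' g ι p ⊔ str p = g.perp (ι p) (tangentImage E' ι p)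
  ltr : ∀ p : M, Submodule ℝ (TangentSpace 𝓘(ℝ, E) (ι p))
  ltr_smooth : IsSmoothSubbundle (E' := E') ι ltr
  ltr_null : ∀ p, ltr p ≤ g.perp (ι p) (ltr p)
  ltr_perp_screen : ∀ p, ltr p ≤ g.perp (ι p) (screen p)
  ltr_perp_str : ∀ p, ltr p ≤ g.perp (ι p) (str p)
  ltr_disjoint_str : ∀ p, Disjoint (ltr p) (str p)
  isCompl_tr : ∀ p, IsCompl (tangentImage E' ι p) (ltr p ⊔ str p)

namespace LightlikeSubmanifold

variable {g : SemiRiemannianMetric E Mb} {ι : M → Mb} (L : LightlikeSubmanifold E' g ι)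

lemma isCompl_screen (p : M) :
    IsCompl (L.screen p) (radical E' g ι p ⊔ (L.ltr p ⊔ L.str p)) := by
  refine (L.rad_disjoint_screen p).symm.isCompl_sup_right_of_isCompl_sup_left ?_
  rw [sup_comm, L.rad_sup_screen p]
  exact L.isCompl_tr p

lemma isCompl_rad (p : M) :
    IsCompl (radical E' g ι p) (L.screen p ⊔ (L.ltr p ⊔ L.str p)) := by
  refine (L.rad_disjoint_screen p).isCompl_sup_right_of_isCompl_sup_left ?_
  rw [L.rad_sup_screen p]
  exact L.isCompl_tr p

lemma isCompl_str (p : M) :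
    IsCompl (L.str p) (L.ltr p ⊔ tangentImage E' ι p) := by
  refine (L.ltr_disjoint_str p).symm.isCompl_sup_right_of_isCompl_sup_left ?_
  rw [sup_comm]
  exact (L.isCompl_tr p).symm

/-! The projections of `T Mb|_M = (Rad TM ⊕ ltr(TM)) ⊥ S(TM) ⊥ S(TM^⊥)` onto `TM`, `S(TM)`,
`Rad TM` and `S(TM^⊥)`, as endomorphisms of `T Mb|_M`. -/

def projTangent (p : M) : TangentSpace 𝓘(ℝ, E) (ι p) →ₗ[ℝ] TangentSpace 𝓘(ℝ, E) (ι p) :=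
  Submodule.projection _ _ (L.isCompl_tr p)

def projScreen (p : M) : TangentSpace 𝓘(ℝ, E) (ι p) →ₗ[ℝ] TangentSpace 𝓘(ℝ, E) (ι p) :=
  Submodule.projection _ _ (L.isCompl_screen p)

def projRad (p : M) : TangentSpace 𝓘(ℝ, E) (ι p) →ₗ[ℝ] TangentSpace 𝓘(ℝ, E) (ι p) :=
  Submodule.projection _ _ (L.isCompl_rad p)

def projStr (p : M) : TangentSpace 𝓘(ℝ, E) (ι p) →ₗ[ℝ] TangentSpace 𝓘(ℝ, E) (ι p) :=
  Submodule.projection _ _ (L.isCompl_str p)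

variable (cov : CovariantDerivative 𝓘(ℝ, E) E (TangentSpace 𝓘(ℝ, E) : Mb → Type _))
  (X : ∀ p : M, TangentSpace 𝓘(ℝ, E') p) (V : ∀ p : M, TangentSpace 𝓘(ℝ, E) (ι p))

/-- The induced connection on `M`: the tangential part of the derivative, for `V ∈ Γ(TM)`. -/
def induced (p : M) : TangentSpace 𝓘(ℝ, E) (ι p) :=
  L.projTangent p (pullbackCov cov ι V p (X p))

/-- The screen second fundamental form `h^s(X, V)`: the `S(TM^⊥)`-part of the derivative. -/
def hs (p : M) : TangentSpace 𝓘(ℝ, E) (ι p) :=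
  L.projStr p (pullbackCov cov ι V p (X p))

/-- The connection induced on the screen, for `V ∈ Γ(S(TM))`: the `S(TM)`-part of `induced`. -/
def inducedStar (p : M) : TangentSpace 𝓘(ℝ, E) (ι p) :=
  L.projScreen p (L.induced cov X V p)

/-- The second fundamental form `h^*(X, V)` of the screen, for `V ∈ Γ(S(TM))`: the `Rad TM`-part of
`induced`. -/
def hstar (p : M) : TangentSpace 𝓘(ℝ, E) (ι p) :=
  L.projRad p (L.induced cov X V p)

/-- A distribution `D` on `M` is parallel for the induced connection if, for all `X, Y ∈ Γ(D)`, the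
derivative of `Y` in the direction `X` lies in `D` again. -/
def IsParallel (D : ∀ p : M, Submodule ℝ (TangentSpace 𝓘(ℝ, E) (ι p))) : Prop :=
  ∀ (X : ∀ p : M, TangentSpace 𝓘(ℝ, E') p) (Y : ∀ p : M, TangentSpace 𝓘(ℝ, E) (ι p)),
    IsFieldIn ι D X → IsSection (E' := E') ι D Y → ∀ p, L.induced cov X Y p ∈ D p

variable (J : BronzeStructure g)

/-- `f v`: the tangential part of `J v`. -/
def f (p : M) (v : TangentSpace 𝓘(ℝ, E) (ι p)) : TangentSpace 𝓘(ℝ, E) (ι p) :=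
  L.projTangent p (J.J (ι p) v)

/-- `B_o = J(S(TM)) ∩ S(TM)`. -/
def Bo (p : M) : Submodule ℝ (TangentSpace 𝓘(ℝ, E) (ι p)) :=
  (L.screen p).map (J.J (ι p)).toLinearMap ⊓ L.screen p

/-- `B'`: the orthogonal complement of `B_o` in `S(TM)`. -/
def Bprime (p : M) : Submodule ℝ (TangentSpace 𝓘(ℝ, E) (ι p)) :=
  L.screen p ⊓ g.perp (ι p) (L.Bo J p)

/-- Screen generic lightlike submanifolds: `Rad TM` is `J`-invariant, `B_o` is a nondegenerate
distribution, and `J Z = f Z + w Z` with `f Z ∈ B'` and `w Z ∈ S(TM^⊥)` for `Z ∈ B'`. -/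
structure IsScreenGeneric : Prop where
  rad_invariant : ∀ p, (radical E' g ι p).map (J.J (ι p)).toLinearMap = radical E' g ι p
  Bo_smooth : IsSmoothSubbundle (E' := E') ι (L.Bo J)
  Bo_nondegenerate : ∀ p, ∀ v ∈ L.Bo J p, (∀ w ∈ L.Bo J p, g.inner (ι p) v w = 0) → v = 0
  J_Bprime : ∀ p, ∀ z ∈ L.Bprime J p, J.J (ι p) z ∈ L.Bprime J p ⊔ L.str p

end LightlikeSubmanifold

end Submanifold

end LightlikeGeometry

end

open LightlikeGeometry

/-! Since `J² = 3J + I`, the operator `J - 3` is inverse to `J`, and both are self-adjoint. For `X`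
in `B_o` the correction `θ(Y)(lX + mJX)` lies in the `J`-invariant `B_o`. So, modulo `B_o`, the
`(l,m)`-connection commutes with `J`, because the Levi-Civita connection does
(`pullbackCov_parallel`). By `projTangent_mem_Bo_iff`, parallelism of `B_o` means that `h^*(X,Y) =
0` and that the derivative `W` of `Y` along `X` is orthogonal to `B'`. Condition 1 reads `g((J - 3)
h^*(X,JY), N) = 0` for all `N`. By the duality of `Rad TM` with `ltr(TM)` and invertibility of `J -
3`, it says `h^*(X,JY) = 0`, and `JY` runs through all of `Γ(B_o)`. The left side of condition 2 is
the pairing of the derivative of `JY` with `JZ`. The condition thus pairs that derivative, `JW`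
modulo `B_o`, to zero with `(J - 3)Z`, and this pairing equals `g(W, Z)`. Passing from sections to
vectors requires global sections through every vector of `ltr(TM)` and `B'`. -/

/-! ### Covariant derivatives along a map, and their commutation with a parallel `J`. -/

section PullbackCov

variable {E : Type*} [NormedAddCommGroup E] [NormedSpace ℝ E]
  {Mb : Type*} [TopologicalSpace Mb] [ChartedSpace E Mb] [IsManifold 𝓘(ℝ, E) ∞ Mb]
  {E' : Type*} [NormedAddCommGroup E'] [NormedSpace ℝ E']
  {M : Type*} [TopologicalSpace M] [ChartedSpace E' M]

/-- The values lie in vector spaces, so in a chart of `M` this is the ordinary product rule. -/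
theorem mfderiv_clm_apply {F : Type*} [NormedAddCommGroup F] [NormedSpace ℝ F]
    {A : M → E →L[ℝ] F} {c : M → E} {p : M} (hA : MDifferentiableAt 𝓘(ℝ, E') 𝓘(ℝ, E →L[ℝ] F) A p)
    (hc : MDifferentiableAt 𝓘(ℝ, E') 𝓘(ℝ, E) c p) (v : TangentSpace 𝓘(ℝ, E') p) :
    mfderiv 𝓘(ℝ, E') 𝓘(ℝ, F) (fun q ↦ A q (c q)) p v
      = (A p (mfderiv 𝓘(ℝ, E') 𝓘(ℝ, E) c p v) +
        (show E →L[ℝ] F from mfderiv 𝓘(ℝ, E') 𝓘(ℝ, E →L[ℝ] F) A p v) (c p) : F) := by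
  have hA' := hA.hasMFDerivAt.2
  have hc' := hc.hasMFDerivAt.2
  have h := HasFDerivWithinAt.clm_apply hA' hc'
  have hAc : HasMFDerivAt 𝓘(ℝ, E') 𝓘(ℝ, F) (fun q ↦ A q (c q)) p _ :=
    ⟨hA.continuousAt.clm_apply hc.continuousAt, h⟩
  rw [hAc.mfderiv]
  have hp : (extChartAt 𝓘(ℝ, E') p).symm (extChartAt 𝓘(ℝ, E') p p) = p := extChartAt_to_inv p
  simp only [writtenInExtChartAt, Function.comp_apply, hp]
  rfl

theorem CovariantDerivative.apply_sum
    (cov : CovariantDerivative 𝓘(ℝ, E) E (TangentSpace 𝓘(ℝ, E) : Mb → Type _))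
    {κ : Type*} (s : Finset κ) (σ : κ → ∀ x : Mb, TangentSpace 𝓘(ℝ, E) x) (x : Mb)
    (hσ : ∀ i ∈ s, MDiffAt (T% (σ i)) x) :
    cov (fun y ↦ ∑ i ∈ s, σ i y) x = ∑ i ∈ s, cov (σ i) x := by
  classical
  induction s using Finset.induction_on with
  | empty =>
    exact congrFun cov.zero x
  | insert a s ha ih =>
    have h1 : MDiffAt (T% (fun y ↦ ∑ i ∈ s, σ i y)) x :=
      MDifferentiableAt.sum_section fun i hi ↦ hσ i (Finset.mem_insert_of_mem hi)
    have := cov.isCovariantDerivativeOnUniv.add (hσ a (Finset.mem_insert_self a s)) h1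
    rw [Finset.sum_insert ha, ← ih fun i hi ↦ hσ i (Finset.mem_insert_of_mem hi), ← this]
    congr 1
    ext y
    simp [Finset.sum_insert ha]

theorem mdifferentiableAt_trivialization_symm (x : Mb) {φ : Mb → E}
    (hφ : MDifferentiableAt 𝓘(ℝ, E) 𝓘(ℝ, E) φ x) :
    MDiffAt (T% (fun y ↦
      (trivializationAt E (TangentSpace 𝓘(ℝ, E) : Mb → Type _) x).symm y (φ y))) x := by
  set e := trivializationAt E (TangentSpace 𝓘(ℝ, E) : Mb → Type _) x with he
  have hx : x ∈ e.baseSet := mem_baseSet_trivializationAt E _ x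
  rw [mdifferentiableAt_section]
  refine hφ.congr_of_eventuallyEq ?_
  filter_upwards [e.open_baseSet.mem_nhds hx] with y hy
  rw [e.mk_symm hy]
  exact congrArg Prod.snd (e.apply_symm_apply (e.mem_target.2 hy))

/-- The derivative of a vector field given by a coefficient vector in a trivialization. -/
theorem CovariantDerivative.apply_trivialization_symm [FiniteDimensional ℝ E]
    (cov : CovariantDerivative 𝓘(ℝ, E) E (TangentSpace 𝓘(ℝ, E) : Mb → Type _))
    (x : Mb) (φ : Mb → E) (hφ : MDifferentiableAt 𝓘(ℝ, E) 𝓘(ℝ, E) φ x)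
    (w : TangentSpace 𝓘(ℝ, E) x) :
    let e := trivializationAt E (TangentSpace 𝓘(ℝ, E) : Mb → Type _) x
    cov (fun y ↦ e.symm y (φ y)) x w
      = e.symm x (mfderiv 𝓘(ℝ, E) 𝓘(ℝ, E) φ x w) + cov (fun y ↦ e.symm y (φ x)) x w := by
  intro e
  have hx : x ∈ e.baseSet := mem_baseSet_trivializationAt E _ x
  let b := Module.finBasis ℝ E
  let ψ (i) : E →L[ℝ] ℝ := (b.coord i).toContinuousLinearMap
  have hsum (u : E) : u = ∑ i, ψ i u • b i := (b.sum_repr u).symm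
  have hsymm (y) (hy : y ∈ e.baseSet) (u : E) : e.symm y u = ∑ i, ψ i u • e.symm y (b i) := by
    conv_lhs => rw [hsum u]
    simp only [← e.symmL_apply (R := ℝ) hy, map_sum, map_smul]
  have hb (i) := mdifferentiableAt_trivialization_symm x (φ := fun _ ↦ b i) mdifferentiableAt_const
  -- Leibniz in the frame given by a basis of `E`. It is used for `φ` and for the constant `φ x`;
  -- the two expansions differ exactly by the terms in the derivative of `φ`.
  have key (χ : Mb → E) (hχ : MDifferentiableAt 𝓘(ℝ, E) 𝓘(ℝ, E) χ x) :
      cov (fun y ↦ e.symm y (χ y)) x w = ∑ i, (ψ i (χ x) • cov (fun y ↦ e.symm y (b i)) x w +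
        ψ i (mfderiv 𝓘(ℝ, E) 𝓘(ℝ, E) χ x w) • e.symm x (b i)) := by
    have hψχ (i) : MDifferentiableAt 𝓘(ℝ, E) 𝓘(ℝ, ℝ) (fun y ↦ ψ i (χ y)) x :=
      (mdifferentiableAt_const (c := ψ i)).clm_apply hχ
    have hd (i) : MDiffAt (T% ((fun y ↦ ψ i (χ y)) • fun y ↦ e.symm y (b i))) x :=
      (hψχ i).smul_section (hb i)
    have h1 : cov (fun y ↦ e.symm y (χ y)) x
        = cov (fun y ↦ ∑ i, ((fun y ↦ ψ i (χ y)) • fun y ↦ e.symm y (b i)) y) x := by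
      refine cov.isCovariantDerivativeOnUniv.congr_of_eventuallyEq
        (mdifferentiableAt_trivialization_symm x hχ)
        (MDifferentiableAt.sum_section fun i _ ↦ hd i) Filter.univ_mem ?_
      filter_upwards [e.open_baseSet.mem_nhds hx] with y hy
      exact hsymm y hy (χ y)
    rw [h1, cov.apply_sum _ _ _ fun i _ ↦ hd i]
    simp only [_root_.sum_apply]
    refine Finset.sum_congr rfl fun i _ ↦ ?_
    rw [cov.isCovariantDerivativeOnUniv.leibniz (hb i) (hψχ i)]
    have h2 := mfderiv_clm_apply (mdifferentiableAt_const (c := ψ i)) hχ w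
    have h3 : d% (fun y ↦ ψ i (χ y)) x w = ψ i (mfderiv 𝓘(ℝ, E) 𝓘(ℝ, E) χ x w) := by
      refine h2.trans ?_
      rw [mfderiv_const]
      exact add_zero _
    rw [_root_.add_apply, _root_.smul_apply, ContinuousLinearMap.smulRight_apply, h3]
  rw [key φ hφ, key (fun _ ↦ φ x) mdifferentiableAt_const, mfderiv_const,
    hsymm x hx (mfderiv 𝓘(ℝ, E) 𝓘(ℝ, E) φ x w), Finset.sum_add_distrib, Finset.sum_add_distrib,
    add_comm]
  congr 1
  have h0 : ∑ i, ψ i 0 • e.symm x (b i) = 0 := by simp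
  exact ((congrArg (_ + ·) h0).trans (add_zero _)).symm

/-- `∇_v (J V) = J (∇_v V)` for vector fields along `ι`, for a parallel `J`. -/
theorem pullbackCov_parallel [FiniteDimensional ℝ E] {g : SemiRiemannianMetric E Mb}
    {J : BronzeStructure g}
    {cov : CovariantDerivative 𝓘(ℝ, E) E (TangentSpace 𝓘(ℝ, E) : Mb → Type _)}
    (hJ : J.IsParallel cov) {ι : M → Mb} {p : M} {V : ∀ q : M, TangentSpace 𝓘(ℝ, E) (ι q)}
    (hV : MDifferentiableAt 𝓘(ℝ, E') 𝓘(ℝ, E).tangent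
      (fun q ↦ (⟨ι q, V q⟩ : TangentBundle 𝓘(ℝ, E) Mb)) p)
    (v : TangentSpace 𝓘(ℝ, E') p) :
    pullbackCov cov ι (fun q ↦ J.J (ι q) (V q)) p v = J.J (ι p) (pullbackCov cov ι V p v) := by
  set e := trivializationAt E (TangentSpace 𝓘(ℝ, E) : Mb → Type _) (ι p) with he
  have hx : ι p ∈ e.baseSet := mem_baseSet_trivializationAt E _ (ι p)
  obtain ⟨hι, hc⟩ := (mdifferentiableAt_totalSpace _ _).1 hV
  set c : M → E := fun q ↦ (e ⟨ι q, V q⟩).2 with hcdef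
  change MDifferentiableAt 𝓘(ℝ, E') 𝓘(ℝ, E) ι p at hι
  change MDifferentiableAt 𝓘(ℝ, E') 𝓘(ℝ, E) c p at hc
  -- `A` is the matrix of `J` in the trivialization around `ι p`.
  let A : Mb → E →L[ℝ] E := fun y ↦ ContinuousLinearMap.inCoordinates E
    (TangentSpace 𝓘(ℝ, E) : Mb → Type _) E (TangentSpace 𝓘(ℝ, E) : Mb → Type _)
    (ι p) y (ι p) y (J.J y)
  have hA : MDifferentiableAt 𝓘(ℝ, E) 𝓘(ℝ, E →L[ℝ] E) A (ι p) :=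
    ((mdifferentiableAt_hom_bundle _).1
      ((J.contMDiff (ι p)).mdifferentiableAt (by simp))).2
  have hAι : MDifferentiableAt 𝓘(ℝ, E') 𝓘(ℝ, E →L[ℝ] E) (fun q ↦ A (ι q)) p := hA.comp p hι
  have hAe (y) (hy : y ∈ e.baseSet) (w : TangentSpace 𝓘(ℝ, E) y) :
      A y (e ⟨y, w⟩).2 = (e ⟨y, J.J y w⟩).2 := by
    change ContinuousLinearMap.inCoordinates E _ E _ (ι p) y (ι p) y (J.J y) _ = _
    rw [ContinuousLinearMap.inCoordinates_eq hy hy]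
    change (e.continuousLinearEquivAt ℝ y hy) (J.J y
      ((e.continuousLinearEquivAt ℝ y hy).symm ((e.continuousLinearEquivAt ℝ y hy) w))) = _
    rw [ContinuousLinearEquiv.symm_apply_apply]
    rfl
  have hAs (y) (hy : y ∈ e.baseSet) (u : E) : J.J y (e.symm y u) = e.symm y (A y u) := by
    have h := hAe y hy (e.symm y u)
    rw [e.apply_mk_symm hy] at h
    rw [h, e.symm_apply_apply_mk hy]
  have hcJ : (fun q ↦ (e ⟨ι q, J.J (ι q) (V q)⟩).2) =ᶠ[𝓝 p] fun q ↦ A (ι q) (c q) := by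
    filter_upwards [hι.continuousAt (e.open_baseSet.mem_nhds hx)] with q hq
    exact (hAe _ hq _).symm
  have hAc : MDifferentiableAt 𝓘(ℝ, E) 𝓘(ℝ, E) (fun y ↦ A y (c p)) (ι p) :=
    hA.clm_apply mdifferentiableAt_const
  have hfield : cov (fun y ↦ J.J y (e.symm y (c p))) (ι p)
      = cov (fun y ↦ e.symm y (A y (c p))) (ι p) := by
    have hs := mdifferentiableAt_trivialization_symm (ι p) (mdifferentiableAt_const (c := c p))
    refine cov.isCovariantDerivativeOnUniv.congr_of_eventuallyEq ?_
      (mdifferentiableAt_trivialization_symm (ι p) hAc) Filter.univ_mem ?_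
    · exact MDifferentiableAt.clm_bundle_apply ((J.contMDiff (ι p)).mdifferentiableAt (by simp)) hs
    · filter_upwards [e.open_baseSet.mem_nhds hx] with y hy
      exact hAs y hy (c p)
  obtain ⟨w, hw⟩ : ∃ w : TangentSpace 𝓘(ℝ, E) (ι p), w = mfderiv 𝓘(ℝ, E') 𝓘(ℝ, E) ι p v :=
    ⟨_, rfl⟩
  obtain ⟨dc, hdc⟩ : ∃ u : E, u = mfderiv 𝓘(ℝ, E') 𝓘(ℝ, E) c p v := ⟨_, rfl⟩
  obtain ⟨dA, hdA⟩ : ∃ B : E →L[ℝ] E, B = mfderiv 𝓘(ℝ, E) 𝓘(ℝ, E →L[ℝ] E) A (ι p) w := ⟨_, rfl⟩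
  obtain ⟨dcJ, hdcJ⟩ : ∃ u : E, u = mfderiv 𝓘(ℝ, E') 𝓘(ℝ, E)
    (fun q ↦ (e ⟨ι q, J.J (ι q) (V q)⟩).2) p v := ⟨_, rfl⟩
  -- The term `dA (c p)` arises here from differentiating the coefficients of `J V`, and in `h1`
  -- from differentiating `J` of the constant-coefficient field. The two occurrences match, so
  -- parallelism is needed only for that ambient field.
  have hdcJ' : dcJ = A (ι p) dc + dA (c p) := by
    rw [hdcJ, hcJ.mfderiv_eq, hdc, hdA, hw]
    refine (mfderiv_clm_apply hAι hc v).trans ?_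
    rw [show mfderiv 𝓘(ℝ, E') 𝓘(ℝ, E →L[ℝ] E) (fun q ↦ A (ι q)) p = _ from mfderiv_comp p hA hι]
    rfl
  have h1 : cov (fun y ↦ e.symm y (A y (c p))) (ι p) w
      = e.symm (ι p) (dA (c p)) + cov (fun y ↦ e.symm y (A (ι p) (c p))) (ι p) w := by
    refine (cov.apply_trivialization_symm (ι p) _ hAc w).trans ?_
    have : mfderiv 𝓘(ℝ, E) 𝓘(ℝ, E) (fun y ↦ A y (c p)) (ι p) w = dA (c p) := by
      refine (mfderiv_clm_apply hA mdifferentiableAt_const w).trans ?_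
      rw [mfderiv_const, hdA]
      exact (congrArg (· + _) (map_zero (A (ι p)))).trans (zero_add _)
    rw [this]
  change e.symm (ι p) (mfderiv 𝓘(ℝ, E') 𝓘(ℝ, E) (fun q ↦ (e ⟨ι q, J.J (ι q) (V q)⟩).2) p v)
      + cov (fun y ↦ e.symm y (e ⟨ι p, J.J (ι p) (V p)⟩).2) (ι p)
        (mfderiv 𝓘(ℝ, E') 𝓘(ℝ, E) ι p v)
    = J.J (ι p) (e.symm (ι p) (mfderiv 𝓘(ℝ, E') 𝓘(ℝ, E) c p v)
      + cov (fun y ↦ e.symm y (c p)) (ι p) (mfderiv 𝓘(ℝ, E') 𝓘(ℝ, E) ι p v))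
  rw [← hw, ← hdc, ← hdcJ, ← hAe _ hx, map_add, hAs _ hx, ← hJ _ _ _
    (mdifferentiableAt_trivialization_symm (ι p) mdifferentiableAt_const), hfield, h1, hdcJ',
    ← e.symmL_apply (R := ℝ) hx, map_add, e.symmL_apply hx, e.symmL_apply hx, add_assoc]

end PullbackCov

/-! ### The `(l,m)`-correction along `ι`, and global sections through given vectors. -/

section Sections

variable {E : Type*} [NormedAddCommGroup E] [NormedSpace ℝ E]
  {Mb : Type*} [TopologicalSpace Mb] [ChartedSpace E Mb] [IsManifold 𝓘(ℝ, E) ∞ Mb]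
  {E' : Type*} [NormedAddCommGroup E'] [NormedSpace ℝ E']
  {M : Type*} [TopologicalSpace M] [ChartedSpace E' M]
  {ι : M → Mb} {p : M}

/-- The correction is tensorial in the differentiated field, so it sees only the value at `ι p` of
the constant-coefficient field, which is `V p`. -/
theorem pullbackCov_lmConnection {g : SemiRiemannianMetric E Mb} (J : BronzeStructure g)
    (D : LMData g)
    (cov : CovariantDerivative 𝓘(ℝ, E) E (TangentSpace 𝓘(ℝ, E) : Mb → Type _))
    (V : ∀ q : M, TangentSpace 𝓘(ℝ, E) (ι q)) (v : TangentSpace 𝓘(ℝ, E') p) :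
    pullbackCov (lmConnection J D cov) ι V p v = pullbackCov cov ι V p v +
      g.inner (ι p) (D.η (ι p)) (V p) • (D.l (ι p) • mfderiv 𝓘(ℝ, E') 𝓘(ℝ, E) ι p v +
        D.m (ι p) • J.J (ι p) (mfderiv 𝓘(ℝ, E') 𝓘(ℝ, E) ι p v)) := by
  set e := trivializationAt E (TangentSpace 𝓘(ℝ, E) : Mb → Type _) (ι p) with he
  have hx : ι p ∈ e.baseSet := mem_baseSet_trivializationAt E _ (ι p)
  have hV : e.symm (ι p) (e ⟨ι p, V p⟩).2 = V p := e.symm_apply_apply_mk hx _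
  conv_rhs => rw [← hV]
  exact (add_assoc _ _ _).symm

/-- Smooth vector fields along `ι` are closed under linear combinations with smooth coefficients. -/
theorem contMDiffAt_along_sum {κ : Type*} (s : Finset κ) (hι : ContMDiffAt 𝓘(ℝ, E') 𝓘(ℝ, E) ∞ ι p)
    {φ : κ → M → ℝ} {V : κ → ∀ q : M, TangentSpace 𝓘(ℝ, E) (ι q)}
    (hφ : ∀ i ∈ s, ContMDiffAt 𝓘(ℝ, E') 𝓘(ℝ, ℝ) ∞ (φ i) p)
    (hV : ∀ i ∈ s, ContMDiffAt 𝓘(ℝ, E') 𝓘(ℝ, E).tangent ∞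
      (fun q ↦ (⟨ι q, V i q⟩ : TangentBundle 𝓘(ℝ, E) Mb)) p) :
    ContMDiffAt 𝓘(ℝ, E') 𝓘(ℝ, E).tangent ∞
      (fun q ↦ (⟨ι q, ∑ i ∈ s, φ i q • V i q⟩ : TangentBundle 𝓘(ℝ, E) Mb)) p := by
  set e := trivializationAt E (TangentSpace 𝓘(ℝ, E) : Mb → Type _) (ι p) with he
  have hx : ι p ∈ e.baseSet := mem_baseSet_trivializationAt E _ (ι p)
  refine contMDiffAt_totalSpace.2 ⟨hι, ?_⟩
  have hc : ContMDiffAt 𝓘(ℝ, E') 𝓘(ℝ, E) ∞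
      (fun q ↦ ∑ i ∈ s, φ i q • (e ⟨ι q, V i q⟩).2) p :=
    contMDiffAt_finsetSum fun i hi ↦ (hφ i hi).smul (contMDiffAt_totalSpace.1 (hV i hi)).2
  refine hc.congr_of_eventuallyEq ?_
  filter_upwards [hι.continuousAt (e.open_baseSet.mem_nhds hx)] with q hq
  change (e ⟨ι q, _⟩).2 = _
  let T := e.continuousLinearEquivAt ℝ (ι q) hq
  change T (∑ i ∈ s, φ i q • V i q) = ∑ i ∈ s, φ i q • T (V i q)
  simp only [map_sum, map_smul]

theorem contMDiffAt_inner_along (g : SemiRiemannianMetric E Mb)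
    (hι : ContMDiffAt 𝓘(ℝ, E') 𝓘(ℝ, E) ∞ ι p)
    {V W : ∀ q : M, TangentSpace 𝓘(ℝ, E) (ι q)}
    (hV : ContMDiffAt 𝓘(ℝ, E') 𝓘(ℝ, E).tangent ∞
      (fun q ↦ (⟨ι q, V q⟩ : TangentBundle 𝓘(ℝ, E) Mb)) p)
    (hW : ContMDiffAt 𝓘(ℝ, E') 𝓘(ℝ, E).tangent ∞
      (fun q ↦ (⟨ι q, W q⟩ : TangentBundle 𝓘(ℝ, E) Mb)) p) :
    ContMDiffAt 𝓘(ℝ, E') 𝓘(ℝ, ℝ) ∞ (fun q ↦ g.inner (ι q) (V q) (W q)) p := by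
  have : ContMDiffAt 𝓘(ℝ, E') (𝓘(ℝ, E).prod 𝓘(ℝ)) ∞
      (fun q ↦ TotalSpace.mk' ℝ (E := Bundle.Trivial Mb ℝ) (ι q) (g.inner (ι q) (V q) (W q))) p := by
    apply ContMDiffAt.clm_bundle_apply₂ (F₁ := E) (F₂ := E)
    · exact ContMDiffAt.comp p (g.contMDiff (ι p)) hι
    · exact hV
    · exact hW
  exact (contMDiffAt_totalSpace.1 this).2

variable [FiniteDimensional ℝ E'] [T2Space M] [IsManifold 𝓘(ℝ, E') ∞ M]

/-- A vector field along `ι` which is smooth near `p` and takes values in `D` there agrees at `p`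
with a global section of `D`. -/
theorem exists_isSection_of_local (hι : ContMDiff 𝓘(ℝ, E') 𝓘(ℝ, E) ∞ ι)
    {D : ∀ q : M, Submodule ℝ (TangentSpace 𝓘(ℝ, E) (ι q))} {U : Set M} (hU : U ∈ 𝓝 p)
    {V : ∀ q : M, TangentSpace 𝓘(ℝ, E) (ι q)}
    (hV : ∀ q ∈ U, ContMDiffAt 𝓘(ℝ, E') 𝓘(ℝ, E).tangent ∞
      (fun q ↦ (⟨ι q, V q⟩ : TangentBundle 𝓘(ℝ, E) Mb)) q)
    (hD : ∀ q ∈ U, V q ∈ D q) :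
    ∃ W, IsSection (E' := E') ι D W ∧ W p = V p := by
  obtain ⟨f, hf⟩ : ∃ f : SmoothBumpFunction 𝓘(ℝ, E') p, tsupport f ⊆ U := by
    simpa using (SmoothBumpFunction.nhds_basis_tsupport (I := 𝓘(ℝ, E')) p).mem_iff.1 hU
  refine ⟨fun q ↦ f q • V q, ⟨fun q ↦ ?_, fun q ↦ ?_⟩, by simp⟩
  · by_cases hq : q ∈ tsupport f
    · simpa using contMDiffAt_along_sum (Finset.univ : Finset Unit) (hι q) (φ := fun _ ↦ f)
        (V := fun _ ↦ V) (fun _ _ ↦ f.contMDiff q) (fun _ _ ↦ hV q (hf hq))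
    · have h0 := contMDiffAt_along_sum (∅ : Finset Unit) (hι q) (φ := fun _ ↦ f)
        (V := fun _ ↦ V) (by simp) (by simp)
      refine h0.congr_of_eventuallyEq ?_
      filter_upwards [(isClosed_tsupport f).isOpen_compl.mem_nhds hq] with y hy
      simp [image_eq_zero_of_notMem_tsupport hy]
  · by_cases hq : q ∈ tsupport f
    · exact (D q).smul_mem _ (hD q (hf hq))
    · simp [image_eq_zero_of_notMem_tsupport hq]

/-- Through every vector of a smooth subbundle there is a global section. -/
theorem LightlikeGeometry.IsSmoothSubbundle.exists_isSection (hι : ContMDiff 𝓘(ℝ, E') 𝓘(ℝ, E) ∞ ι)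
    {D : ∀ q : M, Submodule ℝ (TangentSpace 𝓘(ℝ, E) (ι q))}
    (hD : IsSmoothSubbundle (E' := E') ι D) {v : TangentSpace 𝓘(ℝ, E) (ι p)} (hv : v ∈ D p) :
    ∃ V, IsSection (E' := E') ι D V ∧ V p = v := by
  obtain ⟨U, k, s, hUo, hpU, hs, hspan⟩ := hD p
  rw [← (hspan p hpU).2] at hv
  obtain ⟨a, rfl⟩ := (Submodule.mem_span_range_iff_exists_fun ℝ).1 hv
  refine exists_isSection_of_local hι (hUo.mem_nhds hpU) (V := fun q ↦ ∑ i, a i • s i q)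
    (fun q hq ↦ ?_) fun q hq ↦ ?_
  · exact contMDiffAt_along_sum Finset.univ (hι q) (φ := fun i _ ↦ a i)
      (fun _ _ ↦ contMDiffAt_const) fun i _ ↦ (hs i).contMDiffAt (hUo.mem_nhds hq)
  · rw [← (hspan q hq).2]
    exact Submodule.sum_mem _ fun i _ ↦ Submodule.smul_mem _ _ (Submodule.subset_span ⟨i, rfl⟩)

/-- Through every vector of `S` orthogonal to a nondegenerate subbundle `B ≤ S` there is a global
section of the orthogonal complement of `B` in `S`. -/
theorem LightlikeGeometry.IsSmoothSubbundle.exists_isSection_inf_perp (g : SemiRiemannianMetric E Mb)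
    (hι : ContMDiff 𝓘(ℝ, E') 𝓘(ℝ, E) ∞ ι)
    {S B : ∀ q : M, Submodule ℝ (TangentSpace 𝓘(ℝ, E) (ι q))}
    (hS : IsSmoothSubbundle (E' := E') ι S) (hB : IsSmoothSubbundle (E' := E') ι B)
    (hBS : ∀ q, B q ≤ S q)
    (hnd : ∀ v ∈ B p, (∀ w ∈ B p, g.inner (ι p) v w = 0) → v = 0)
    {z : TangentSpace 𝓘(ℝ, E) (ι p)} (hz : z ∈ S p ⊓ g.perp (ι p) (B p)) :
    ∃ Z, IsSection (E' := E') ι (fun q ↦ S q ⊓ g.perp (ι q) (B q)) Z ∧ Z p = z := by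
  obtain ⟨Z, hZ, rfl⟩ := hS.exists_isSection hι hz.1
  obtain ⟨U, k, t, hUo, hpU, ht, hspan⟩ := hB p
  have htm (q) (hq : q ∈ U) (i) : t i q ∈ B q := by
    rw [← (hspan q hq).2]
    exact Submodule.subset_span ⟨i, rfl⟩
  -- Gram–Schmidt with denominators cleared: `det G • Z - ∑ a i • t i` is orthogonal to `B` on all
  -- of `U`, even where `det G` vanishes. Only the constant `det G(p)` is divided out at the end.
  let G : M → Matrix (Fin k) (Fin k) ℝ := fun q i j ↦ g.inner (ι q) (t i q) (t j q)
  let a : Fin k → M → ℝ := fun i q ↦ ∑ j, g.inner (ι q) (Z q) (t j q) * (G q).adjugate j i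
  have hG (q) (hq : q ∈ U) (i j) : ContMDiffAt 𝓘(ℝ, E') 𝓘(ℝ, ℝ) ∞ (fun q ↦ G q i j) q :=
    contMDiffAt_inner_along g (hι q) ((ht i).contMDiffAt (hUo.mem_nhds hq))
      ((ht j).contMDiffAt (hUo.mem_nhds hq))
  have hdet {N : M → Matrix (Fin k) (Fin k) ℝ} {q : M}
      (hN : ∀ i j, ContMDiffAt 𝓘(ℝ, E') 𝓘(ℝ, ℝ) ∞ (fun q ↦ N q i j) q) :
      ContMDiffAt 𝓘(ℝ, E') 𝓘(ℝ, ℝ) ∞ (fun q ↦ (N q).det) q := by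
    simp only [Matrix.det_apply']
    exact contMDiffAt_finsetSum fun σ _ ↦ contMDiffAt_const.mul
      (contMDiffAt_finsetProd fun i _ ↦ hN _ _)
  have hadj (q) (hq : q ∈ U) (i j) :
      ContMDiffAt 𝓘(ℝ, E') 𝓘(ℝ, ℝ) ∞ (fun q ↦ (G q).adjugate i j) q := by
    -- Each entry of the adjugate is the determinant of `G` with one row replaced by a unit vector.
    simp only [Matrix.adjugate_apply]
    refine hdet fun i' j' ↦ ?_
    by_cases h : i' = j
    · subst h
      simpa using contMDiffAt_const
    · simpa [Matrix.updateRow_ne h] using hG q hq i' j'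
  have ha (q) (hq : q ∈ U) (i) : ContMDiffAt 𝓘(ℝ, E') 𝓘(ℝ, ℝ) ∞ (a i) q :=
    contMDiffAt_finsetSum fun j _ ↦ (contMDiffAt_inner_along g (hι q) (hZ.smooth q)
      ((ht j).contMDiffAt (hUo.mem_nhds hq))).mul (hadj q hq j i)
  -- A kernel vector of the Gram matrix would give a nonzero vector of `B p` orthogonal to `B p`.
  have hdet0 : (G p).det ≠ 0 := by
    intro h0
    obtain ⟨c, hc, hGc⟩ := Matrix.exists_mulVec_eq_zero_iff.2 h0
    refine hc (funext (Fintype.linearIndependent_iff.1 (hspan p hpU).1 c (hnd _ ?_ ?_)))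
    · exact Submodule.sum_mem _ fun i _ ↦ Submodule.smul_mem _ _ (htm p hpU i)
    · intro w hw
      rw [← (hspan p hpU).2] at hw
      obtain ⟨b, rfl⟩ := (Submodule.mem_span_range_iff_exists_fun ℝ).1 hw
      have hj (j) : g.inner (ι p) (∑ i, c i • t i p) (t j p) = 0 := by
        have := congrFun hGc j
        simp only [Matrix.mulVec, dotProduct, G, Pi.zero_apply] at this
        rw [g.symm, map_sum, ← this]
        exact Finset.sum_congr rfl fun i _ ↦ by simp [mul_comm]
      rw [map_sum]
      exact Finset.sum_eq_zero fun i _ ↦ by rw [map_smul, hj, smul_zero]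
  have hap (i) : a i p = 0 :=
    Finset.sum_eq_zero fun j _ ↦ by rw [hz.2 _ (htm p hpU j), zero_mul]
  let V : ∀ q : M, TangentSpace 𝓘(ℝ, E) (ι q) := fun q ↦
    -- `none` indexes the `Z` term, `some i` the frame of `B`.
    ∑ o : Option (Fin k), (o.elim (G q).det fun i ↦ - a i q) • (o.elim (Z q) fun i ↦ t i q)
  have hVs (q) (hq : q ∈ U) : ContMDiffAt 𝓘(ℝ, E') 𝓘(ℝ, E).tangent ∞
      (fun q ↦ (⟨ι q, V q⟩ : TangentBundle 𝓘(ℝ, E) Mb)) q := by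
    refine contMDiffAt_along_sum Finset.univ (hι q) (φ := fun (o : Option (Fin k)) q ↦ o.elim (G q).det fun i ↦ - a i q)
      (V := fun (o : Option (Fin k)) q ↦ o.elim (Z q) fun i ↦ t i q) (fun o _ ↦ ?_) (fun o _ ↦ ?_)
    · cases o with
      | none => exact hdet (hG q hq)
      | some i => exact (ha q hq i).neg
    · cases o with
      | none => exact hZ.smooth q
      | some i => exact (ht i).contMDiffAt (hUo.mem_nhds hq)
  have hVm (q) (hq : q ∈ U) : V q ∈ S q ⊓ g.perp (ι q) (B q) := by
    simp only [V, Fintype.sum_option, Option.elim]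
    refine ⟨add_mem (Submodule.smul_mem _ _ (hZ.mem q)) (Submodule.sum_mem _ fun i _ ↦
      Submodule.smul_mem _ _ (hBS q (htm q hq i))), fun w hw ↦ ?_⟩
    rw [← (hspan q hq).2] at hw
    obtain ⟨b, rfl⟩ := (Submodule.mem_span_range_iff_exists_fun ℝ).1 hw
    have hadjG (j l) : ∑ i, (G q).adjugate j i * G q i l = if j = l then (G q).det else 0 := by
      simpa [Matrix.mul_apply, Matrix.one_apply] using
        congrFun (congrFun (G q).adjugate_mul j) l
    have key (l) : ∑ i, a i q * G q i l = (G q).det * g.inner (ι q) (Z q) (t l q) := by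
      simp only [a, Finset.sum_mul]
      rw [Finset.sum_comm]
      simp only [mul_assoc, ← Finset.mul_sum, hadjG]
      simp [mul_comm]
    have hl (l) : g.inner (ι q) ((G q).det • Z q + ∑ i, -a i q • t i q) (t l q) = 0 := by
      rw [g.symm, map_add, map_sum, map_smul, smul_eq_mul, g.symm _ (t l q) (Z q), ← key,
        ← Finset.sum_add_distrib]
      refine Finset.sum_eq_zero fun i _ ↦ ?_
      rw [map_smul, g.symm _ (t l q), smul_eq_mul, neg_mul]
      exact add_neg_cancel _
    rw [map_sum]
    exact Finset.sum_eq_zero fun i _ ↦ by rw [map_smul, hl, smul_zero]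
  obtain ⟨W, hW, hWp⟩ := exists_isSection_of_local hι (hUo.mem_nhds hpU) hVs hVm
  refine ⟨fun q ↦ (G p).det⁻¹ • W q, ⟨fun q ↦ ?_, fun q ↦ Submodule.smul_mem _ _ (hW.mem q)⟩, ?_⟩
  · simpa using contMDiffAt_along_sum (Finset.univ : Finset Unit) (hι q)
      (φ := fun _ _ ↦ (G p).det⁻¹) (V := fun _ ↦ W) (fun _ _ ↦ contMDiffAt_const)
      (fun _ _ ↦ hW.smooth q)
  · simp [hWp, V, Fintype.sum_option, hap, smul_smul, inv_mul_cancel₀ hdet0]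

end Sections

/-! ### Pointwise linear algebra of the decomposition, of `J` and of `B_o`. -/

namespace LightlikeGeometry.LightlikeSubmanifold

variable {E : Type*} [NormedAddCommGroup E] [NormedSpace ℝ E]
  {Mb : Type*} [TopologicalSpace Mb] [ChartedSpace E Mb] [IsManifold 𝓘(ℝ, E) ∞ Mb]
  {E' : Type*} [NormedAddCommGroup E'] [NormedSpace ℝ E']
  {M : Type*} [TopologicalSpace M] [ChartedSpace E' M] [IsManifold 𝓘(ℝ, E') ∞ M]
  {g : SemiRiemannianMetric E Mb} {ι : M → Mb} (L : LightlikeSubmanifold E' g ι)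
  {J : BronzeStructure g} {p : M}

theorem screen_le_tangentImage : L.screen p ≤ tangentImage E' ι p :=
  le_sup_right.trans (L.rad_sup_screen p).le

theorem str_le_perp : L.str p ≤ g.perp (ι p) (tangentImage E' ι p) :=
  le_sup_right.trans (L.rad_sup_str p).le

theorem str_le_perp_radical {t r : TangentSpace 𝓘(ℝ, E) (ι p)} (ht : t ∈ L.str p)
    (hr : r ∈ radical E' g ι p) : g.inner (ι p) t r = 0 :=
  L.str_le_perp ht r hr.1

/-- The decomposition `T Mb|_M = Rad TM ⊕ S(TM) ⊕ ltr(TM) ⊕ S(TM^⊥)` and its projections. -/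
theorem exists_decomposition (w : TangentSpace 𝓘(ℝ, E) (ι p)) :
    ∃ r ∈ radical E' g ι p, ∃ s ∈ L.screen p, ∃ n ∈ L.ltr p, ∃ t ∈ L.str p,
      w = r + s + (n + t) ∧ L.projTangent p w = r + s ∧ L.projRad p (L.projTangent p w) = r ∧
        L.projScreen p (L.projTangent p w) = s ∧ L.projStr p w = t := by
  obtain ⟨a, ha, b, hb, rfl⟩ :=
    Submodule.mem_sup.1 ((L.isCompl_tr p).sup_eq_top.ge (Submodule.mem_top (x := w)))
  obtain ⟨n, hn, t, ht, rfl⟩ := Submodule.mem_sup.1 hb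
  rw [← L.rad_sup_screen p] at ha
  obtain ⟨r, hr, s, hs, rfl⟩ := Submodule.mem_sup.1 ha
  have hT : L.projTangent p (r + s + (n + t)) = r + s := by
    rw [L.rad_sup_screen p] at ha
    rw [map_add, projTangent, Submodule.projection_apply_of_mem_left _ ha,
      Submodule.projection_apply_of_mem_right _ hb, add_zero]
  refine ⟨r, hr, s, hs, n, hn, t, ht, rfl, hT, ?_, ?_, ?_⟩
  · rw [hT, map_add, projRad, Submodule.projection_apply_of_mem_left _ hr,
      Submodule.projection_apply_of_mem_right _ (Submodule.mem_sup_left hs), add_zero]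
  · rw [hT, map_add, projScreen, Submodule.projection_apply_of_mem_left _ hs,
      Submodule.projection_apply_of_mem_right _ (Submodule.mem_sup_left hr), zero_add]
  · rw [L.rad_sup_screen p] at ha
    rw [map_add, map_add _ n t, projStr, Submodule.projection_apply_of_mem_left _ ht,
      Submodule.projection_apply_of_mem_right _ (Submodule.mem_sup_left hn),
      Submodule.projection_apply_of_mem_right _ (Submodule.mem_sup_right ha), zero_add, zero_add]

/-- `Rad TM` and `ltr(TM)` are in duality. -/
theorem eq_zero_of_mem_radical {v : TangentSpace 𝓘(ℝ, E) (ι p)} (hv : v ∈ radical E' g ι p)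
    (h : ∀ n ∈ L.ltr p, g.inner (ι p) v n = 0) : v = 0 := by
  -- A radical vector is orthogonal to `TM` and to `S(TM^⊥)`, so only the `ltr(TM)`-part of `w` can
  -- pair with it.
  refine g.nondegenerate (ι p) v fun w ↦ ?_
  obtain ⟨r, hr, s, hs, n, hn, t, ht, rfl, -⟩ := L.exists_decomposition w
  rw [map_add, map_add, map_add, hv.2 r hr.1, hv.2 s (L.screen_le_tangentImage hs), h n hn,
    g.symm, L.str_le_perp_radical ht hv]
  simp

/-- The other three summands are orthogonal to `S(TM)`. This trades the screen part of a derivative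
for the full derivative. -/
theorem inner_projScreen (w : TangentSpace 𝓘(ℝ, E) (ι p)) {z : TangentSpace 𝓘(ℝ, E) (ι p)}
    (hz : z ∈ L.screen p) :
    g.inner (ι p) (L.projScreen p (L.projTangent p w)) z = g.inner (ι p) w z := by
  obtain ⟨r, hr, s, hs, n, hn, t, ht, hw, -, -, h, -⟩ := L.exists_decomposition w
  rw [h, hw]
  simp only [map_add, _root_.add_apply, hr.2 z (L.screen_le_tangentImage hz),
    L.ltr_perp_screen p hn z hz, L.str_le_perp ht z (L.screen_le_tangentImage hz)]
  simp

theorem inner_projStr (w : TangentSpace 𝓘(ℝ, E) (ι p)) {t : TangentSpace 𝓘(ℝ, E) (ι p)}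
    (ht : t ∈ L.str p) : g.inner (ι p) (L.projStr p w) t = g.inner (ι p) w t := by
  obtain ⟨r, hr, s, hs, n, hn, t', ht', hw, -, -, -, h⟩ := L.exists_decomposition w
  rw [h, hw]
  simp only [map_add, _root_.add_apply, g.symm _ r t, g.symm _ s t, L.str_le_perp_radical ht hr,
    L.str_le_perp ht s (L.screen_le_tangentImage hs), L.ltr_perp_str p hn t ht]
  simp

theorem Bo_le_screen : L.Bo J p ≤ L.screen p := inf_le_right

theorem Bprime_le_screen : L.Bprime J p ≤ L.screen p := inf_le_left

/-- `B_o` is `J`-invariant. -/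
theorem J_mem_Bo {v : TangentSpace 𝓘(ℝ, E) (ι p)} (hv : v ∈ L.Bo J p) :
    J.J (ι p) v ∈ L.Bo J p := by
  obtain ⟨⟨u, hu, rfl⟩, hv⟩ := hv
  refine ⟨⟨_, hv, rfl⟩, ?_⟩
  change J.J (ι p) (J.J (ι p) u) ∈ _
  rw [J.sq]
  -- For `v = J u` with `u` and `v` in the screen, `J v = 3v + u`.
  exact add_mem (Submodule.smul_mem _ _ hv) hu

theorem J_sub_mem_Bo {v : TangentSpace 𝓘(ℝ, E) (ι p)} (hv : v ∈ L.Bo J p) :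
    J.J (ι p) v - (3 : ℝ) • v ∈ L.Bo J p :=
  sub_mem (L.J_mem_Bo hv) (Submodule.smul_mem _ _ hv)

/-- `J - 3` is the inverse of `J`; this is the source of the constant 3 in both conditions. -/
theorem _root_.LightlikeGeometry.BronzeStructure.J_J_sub {x : Mb} (v : TangentSpace 𝓘(ℝ, E) x) :
    J.J x (J.J x v - (3 : ℝ) • v) = v := by
  rw [map_sub, map_smul, J.sq]
  abel

theorem _root_.LightlikeGeometry.BronzeStructure.inner_J_sub {x : Mb}
    (v w : TangentSpace 𝓘(ℝ, E) x) :
    g.inner x v (J.J x w - (3 : ℝ) • w) = g.inner x (J.J x v - (3 : ℝ) • v) w := by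
  simp only [map_sub, map_smul, _root_.sub_apply, _root_.smul_apply, J.compatible]

/-- Split `J z` into `f z` in `B'` and `w z` in `S(TM^⊥)`: the screen part sees the first, the
`S(TM^⊥)`-part only the second. The left side of condition 2 is thus a single inner product. -/
theorem inner_projScreen_f_add (hL : L.IsScreenGeneric J)
    (w : TangentSpace 𝓘(ℝ, E) (ι p)) {z : TangentSpace 𝓘(ℝ, E) (ι p)}
    (hz : z ∈ L.Bprime J p) :
    g.inner (ι p) (L.projScreen p (L.projTangent p w)) (L.f J p z)
      + g.inner (ι p) (L.projStr p w) (J.J (ι p) z) = g.inner (ι p) w (J.J (ι p) z) := by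
  obtain ⟨u, hu, t, ht, hut⟩ := Submodule.mem_sup.1 (hL.J_Bprime p z hz)
  have huT := L.screen_le_tangentImage (L.Bprime_le_screen hu)
  have hf : L.f J p z = u := by
    rw [f, ← hut, map_add, projTangent, Submodule.projection_apply_of_mem_left _ huT,
      Submodule.projection_apply_of_mem_right _ (Submodule.mem_sup_right ht), add_zero]
  have hs : L.projStr p w ∈ L.str p := Submodule.projection_apply_mem _ _
  rw [hf, ← hut, map_add, map_add, L.inner_projScreen w (L.Bprime_le_screen hu),
    L.inner_projStr w ht, L.str_le_perp hs u huT, zero_add]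

/-- `B_o` is the orthogonal complement of `B'` in `S(TM)`. -/
theorem mem_Bo_of_orthogonal [FiniteDimensional ℝ E] (hL : L.IsScreenGeneric J)
    {v : TangentSpace 𝓘(ℝ, E) (ι p)}
    (hv : v ∈ L.screen p) (h : ∀ z ∈ L.Bprime J p, g.inner (ι p) v z = 0) : v ∈ L.Bo J p := by
  have : FiniteDimensional ℝ (TangentSpace 𝓘(ℝ, E) (ι p)) := inferInstanceAs (FiniteDimensional ℝ E)
  -- By nondegeneracy and finite dimension, `φ` maps `B_o` isomorphically onto its dual, which
  -- yields orthogonal projection to `B_o`.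
  let φ : TangentSpace 𝓘(ℝ, E) (ι p) →ₗ[ℝ] Module.Dual ℝ (L.Bo J p) :=
    { toFun := fun x ↦ (g.inner (ι p) x).toLinearMap ∘ₗ (L.Bo J p).subtype
      map_add' := fun x y ↦ by ext; simp
      map_smul' := fun c x ↦ by ext; simp }
  have hinj : Function.Injective (φ ∘ₗ (L.Bo J p).subtype) := by
    rw [← LinearMap.ker_eq_bot, LinearMap.ker_eq_bot']
    intro b hb
    exact Subtype.ext (hL.Bo_nondegenerate p b b.2 fun w hw ↦
      LinearMap.congr_fun hb (⟨w, hw⟩ : L.Bo J p))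
  have hproj (x : TangentSpace 𝓘(ℝ, E) (ι p)) :
      ∃ b ∈ L.Bo J p, ∀ w ∈ L.Bo J p, g.inner (ι p) (x - b) w = 0 := by
    obtain ⟨b, hb⟩ := (LinearMap.injective_iff_surjective_of_finrank_eq_finrank
      Subspace.dual_finrank_eq.symm).1 hinj (φ x)
    refine ⟨b, b.2, fun w hw ↦ ?_⟩
    rw [map_sub, _root_.sub_apply, sub_eq_zero]
    exact (LinearMap.congr_fun hb (⟨w, hw⟩ : L.Bo J p)).symm
  obtain ⟨b, hb, hbv⟩ := hproj v
  have hz : v - b ∈ L.Bprime J p := ⟨sub_mem hv (L.Bo_le_screen hb), hbv⟩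
  -- `v - b` is orthogonal to `B_o` and to `B'`, hence to `S(TM)` and to `TM`; so it lies in `Rad TM
  -- ∩ S(TM) = 0`.
  have hz' (x) (hx : x ∈ L.screen p) : g.inner (ι p) (v - b) x = 0 := by
    obtain ⟨c, hc, hcx⟩ := hproj x
    rw [← sub_add_cancel x c, map_add, hbv c hc, map_sub (g.inner (ι p)), _root_.sub_apply,
      h _ ⟨sub_mem hx (L.Bo_le_screen hc), hcx⟩, g.symm, hcx b hb]
    simp
  have : v - b ∈ radical E' g ι p ⊓ L.screen p := by
    refine ⟨⟨L.screen_le_tangentImage hz.1, fun x hx ↦ ?_⟩, hz.1⟩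
    rw [← L.rad_sup_screen p] at hx
    obtain ⟨r, hr, s, hs, rfl⟩ := Submodule.mem_sup.1 hx
    rw [map_add, hz' s hs, g.symm, hr.2 _ (L.screen_le_tangentImage hz.1), add_zero]
  rw [(L.rad_disjoint_screen p).eq_bot, Submodule.mem_bot, sub_eq_zero] at this
  rw [this]
  exact hb

end LightlikeGeometry.LightlikeSubmanifold

/-! ### The two conditions and the equivalence. -/

section Main

variable {E : Type*} [NormedAddCommGroup E] [NormedSpace ℝ E]
  {Mb : Type*} [TopologicalSpace Mb] [ChartedSpace E Mb] [IsManifold 𝓘(ℝ, E) ∞ Mb]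
  {E' : Type*} [NormedAddCommGroup E'] [NormedSpace ℝ E']
  {M : Type*} [TopologicalSpace M] [ChartedSpace E' M] [IsManifold 𝓘(ℝ, E') ∞ M]
  {g : SemiRiemannianMetric E Mb} {J : BronzeStructure g} {ι : M → Mb}
  {L : LightlikeSubmanifold E' g ι} {p : M}

theorem isSection_Bo_J {Y : ∀ p : M, TangentSpace 𝓘(ℝ, E) (ι p)}
    (hY : IsSection (E' := E') ι (L.Bo J) Y) :
    IsSection (E' := E') ι (L.Bo J) (fun p ↦ J.J (ι p) (Y p)) where
  smooth := (J.contMDiff.comp L.immersion.contMDiff).clm_bundle_apply hY.smooth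
  mem p := L.J_mem_Bo (hY.mem p)

/-- Every section of `B_o` is thereby `J` of a section of `B_o`, which lets condition 1 speak about
`Y` itself. -/
theorem isSection_Bo_J_sub {Y : ∀ p : M, TangentSpace 𝓘(ℝ, E) (ι p)}
    (hY : IsSection (E' := E') ι (L.Bo J) Y) :
    IsSection (E' := E') ι (L.Bo J) (fun p ↦ J.J (ι p) (Y p) - (3 : ℝ) • Y p) where
  smooth p := by
    simpa [← sub_eq_add_neg] using contMDiffAt_along_sum Finset.univ (L.immersion.contMDiff p)
      (φ := fun (i : Bool) _ ↦ bif i then 1 else -3)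
      (V := fun (i : Bool) p ↦ bif i then J.J (ι p) (Y p) else Y p)
      (fun i _ ↦ contMDiffAt_const) (fun i _ ↦ match i with
        | true => (isSection_Bo_J hY).smooth p
        | false => hY.smooth p)
  mem p := L.J_sub_mem_Bo (hY.mem p)

/-- In directions of the `J`-invariant `B_o` the correction lies in `B_o`, so it is invisible to
`B'`. -/
theorem exists_pullbackCov_lmConnection (D : LMData g)
    (cov : CovariantDerivative 𝓘(ℝ, E) E (TangentSpace 𝓘(ℝ, E) : Mb → Type _))
    (V : ∀ q : M, TangentSpace 𝓘(ℝ, E) (ι q)) {v : TangentSpace 𝓘(ℝ, E') p}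
    (hv : mfderiv 𝓘(ℝ, E') 𝓘(ℝ, E) ι p v ∈ L.Bo J p) :
    ∃ b ∈ L.Bo J p,
      pullbackCov (lmConnection J D cov) ι V p v = pullbackCov cov ι V p v + b :=
  ⟨_, Submodule.smul_mem _ _ (add_mem (Submodule.smul_mem _ _ hv)
    (Submodule.smul_mem _ _ (L.J_mem_Bo hv))), pullbackCov_lmConnection J D cov V v⟩

/-- The tangential part of the `(l, m)`-derivative lies in `B_o` if and only if its radical part
vanishes and it is orthogonal to `B'`. -/
theorem projTangent_mem_Bo_iff [FiniteDimensional ℝ E] (hL : L.IsScreenGeneric J)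
    (w : TangentSpace 𝓘(ℝ, E) (ι p)) :
    L.projTangent p w ∈ L.Bo J p ↔
      L.projRad p (L.projTangent p w) = 0 ∧ ∀ z ∈ L.Bprime J p, g.inner (ι p) w z = 0 := by
  obtain ⟨r, hr, s, hs, n, hn, t, ht, hw, hT, hR, hS, -⟩ := L.exists_decomposition w
  have hz (z) (hz : z ∈ L.Bprime J p) : g.inner (ι p) w z = g.inner (ι p) s z := by
    rw [← L.inner_projScreen w (L.Bprime_le_screen hz), hS]
  constructor
  · intro h
    have hr0 : L.projRad p (L.projTangent p w) = 0 :=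
      Submodule.projection_apply_of_mem_right _ (Submodule.mem_sup_left (L.Bo_le_screen h))
    refine ⟨hr0, fun z hzB ↦ ?_⟩
    rw [hz z hzB, g.symm]
    refine hzB.2 s ?_
    rwa [hT, ← hR, hr0, zero_add] at h
  · rintro ⟨h0, h⟩
    rw [hT, ← hR, h0, zero_add]
    exact L.mem_Bo_of_orthogonal hL hs fun z hzB ↦ (hz z hzB).symm.trans (h z hzB)

/-- The second condition, at a point, says that `∇_X Y` is orthogonal to `Z`. -/
theorem inner_inducedStar_eq_iff [FiniteDimensional ℝ E]
    {nabla : CovariantDerivative 𝓘(ℝ, E) E (TangentSpace 𝓘(ℝ, E) : Mb → Type _)}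
    (hJ : J.IsParallel nabla) (D : LMData g) (hL : L.IsScreenGeneric J)
    {X : ∀ p : M, TangentSpace 𝓘(ℝ, E') p} {Y : ∀ p : M, TangentSpace 𝓘(ℝ, E) (ι p)}
    (hX : IsFieldIn ι (L.Bo J) X) (hY : IsSection (E' := E') ι (L.Bo J) Y)
    {z : TangentSpace 𝓘(ℝ, E) (ι p)} (hz : z ∈ L.Bprime J p) :
    g.inner (ι p) (L.inducedStar (lmConnection J D nabla) X (fun p ↦ J.J (ι p) (Y p)) p)
          (L.f J p z)
        + g.inner (ι p) (L.hs (lmConnection J D nabla) X (fun p ↦ J.J (ι p) (Y p)) p)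
          (J.J (ι p) z)
      = 3 * g.inner (ι p)
          (L.inducedStar (lmConnection J D nabla) X (fun p ↦ J.J (ι p) (Y p)) p) z ↔
    g.inner (ι p) (pullbackCov (lmConnection J D nabla) ι Y p (X p)) z = 0 := by
  obtain ⟨b, hb, hb'⟩ := exists_pullbackCov_lmConnection D nabla Y (hX.mem p)
  obtain ⟨c, hc, hc'⟩ := exists_pullbackCov_lmConnection (L := L) D nabla
    (fun p ↦ J.J (ι p) (Y p)) (hX.mem p)
  rw [pullbackCov_parallel hJ ((hY.smooth p).mdifferentiableAt (by simp))] at hc'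
  have hBz (b) (hb : b ∈ L.Bo J p) : g.inner (ι p) b z = 0 := by
    rw [g.symm]
    exact hz.2 b hb
  simp only [LightlikeSubmanifold.inducedStar, LightlikeSubmanifold.hs,
    LightlikeSubmanifold.induced]
  rw [L.inner_projScreen_f_add hL _ hz, L.inner_projScreen _ (L.Bprime_le_screen hz), hb', hc',
    ← sub_eq_zero]
  -- Pair with `(J - 3) z`: moving `J` across gives `J (J - 3) z = z`, while `c` contributes the
  -- pairing of `(J - 3) c`, an element of `B_o`, with `z`.
  have h1 : g.inner (ι p) (J.J (ι p) (pullbackCov nabla ι Y p (X p)) + c) (J.J (ι p) z)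
      - 3 * g.inner (ι p) (J.J (ι p) (pullbackCov nabla ι Y p (X p)) + c) z
      = g.inner (ι p) (pullbackCov nabla ι Y p (X p)) z := by
    rw [← smul_eq_mul, ← map_smul, ← map_sub, map_add, _root_.add_apply, ← J.compatible,
      J.J_J_sub, J.inner_J_sub c, hBz _ (L.J_sub_mem_Bo hc), add_zero]
  rw [h1, map_add, _root_.add_apply, hBz b hb, add_zero]

end Main

theorem mainTheorem7
    {E : Type*} [NormedAddCommGroup E] [NormedSpace ℝ E] [FiniteDimensional ℝ E]
    {Mb : Type*} [TopologicalSpace Mb] [T2Space Mb] [ChartedSpace E Mb]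
    [IsManifold 𝓘(ℝ, E) ∞ Mb]
    {E' : Type*} [NormedAddCommGroup E'] [NormedSpace ℝ E'] [FiniteDimensional ℝ E']
    {M : Type*} [TopologicalSpace M] [T2Space M] [ChartedSpace E' M] [IsManifold 𝓘(ℝ, E') ∞ M]
    (g : SemiRiemannianMetric E Mb) (J : BronzeStructure g)
    (nabla : CovariantDerivative 𝓘(ℝ, E) E (TangentSpace 𝓘(ℝ, E) : Mb → Type _))
    (hnabla : IsLeviCivita g nabla) (hJ : J.IsParallel nabla)
    (D : LMData g)
    (ι : M → Mb) (L : LightlikeSubmanifold E' g ι) (hL : L.IsScreenGeneric J) :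
    let Ω := lmConnection J D nabla
    L.IsParallel Ω (L.Bo J) ↔
      (∀ (X : ∀ p : M, TangentSpace 𝓘(ℝ, E') p) (Y N : ∀ p : M, TangentSpace 𝓘(ℝ, E) (ι p)),
        IsFieldIn ι (L.Bo J) X → IsSection (E' := E') ι (L.Bo J) Y →
        IsSection (E' := E') ι L.ltr N →
        let JY : ∀ p : M, TangentSpace 𝓘(ℝ, E) (ι p) := fun p ↦ J.J (ι p) (Y p)
        ∀ p, g.inner (ι p) (L.hstar Ω X JY p) (J.J (ι p) (N p))
          = 3 * g.inner (ι p) (L.hstar Ω X JY p) (N p)) ∧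
      (∀ (X : ∀ p : M, TangentSpace 𝓘(ℝ, E') p) (Y Z : ∀ p : M, TangentSpace 𝓘(ℝ, E) (ι p)),
        IsFieldIn ι (L.Bo J) X → IsSection (E' := E') ι (L.Bo J) Y →
        IsSection (E' := E') ι (L.Bprime J) Z →
        let JY : ∀ p : M, TangentSpace 𝓘(ℝ, E) (ι p) := fun p ↦ J.J (ι p) (Y p)
        ∀ p, g.inner (ι p) (L.inducedStar Ω X JY p) (L.f J p (Z p))
            + g.inner (ι p) (L.hs Ω X JY p) (J.J (ι p) (Z p))
          = 3 * g.inner (ι p) (L.inducedStar Ω X JY p) (Z p)) := by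
  intro Ω
  constructor
  · intro h
    constructor
    · intro X Y N hX hY hN JY p
      have h0 : L.hstar Ω X JY p = 0 :=
        ((projTangent_mem_Bo_iff hL _).1 (h X JY hX (isSection_Bo_J hY) p)).1
      simp [h0]
    · intro X Y Z hX hY hZ JY p
      exact (inner_inducedStar_eq_iff hJ D hL hX hY (hZ.mem p)).2
        (((projTangent_mem_Bo_iff hL _).1 (h X Y hX hY p)).2 _ (hZ.mem p))
  · rintro ⟨h1, h2⟩ X Y hX hY p
    refine (projTangent_mem_Bo_iff hL _).2 ⟨?_, fun z hz ↦ ?_⟩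
    · have hr : L.hstar Ω X Y p ∈ radical E' g ι p := Submodule.projection_apply_mem _ _
      have hJr : J.J (ι p) (L.hstar Ω X Y p) - (3 : ℝ) • L.hstar Ω X Y p ∈ radical E' g ι p :=
        sub_mem ((hL.rad_invariant p).le ⟨_, hr, rfl⟩) (Submodule.smul_mem _ _ hr)
      have h0 : J.J (ι p) (L.hstar Ω X Y p) - (3 : ℝ) • L.hstar Ω X Y p = 0 := by
        refine L.eq_zero_of_mem_radical hJr fun n hn ↦ ?_
        obtain ⟨N, hN, rfl⟩ := L.ltr_smooth.exists_isSection L.immersion.contMDiff hn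
        -- Condition 1 is applied to `(J - 3) Y`, whose image under `J` is `Y`.
        have h := h1 X _ N hX (isSection_Bo_J_sub hY) hN p
        simp only [J.J_J_sub] at h
        rw [← J.inner_J_sub, map_sub, map_smul, h, smul_eq_mul, sub_self]
      change L.hstar Ω X Y p = 0
      rw [← J.J_J_sub (L.hstar Ω X Y p), h0, map_zero]
    · obtain ⟨Z, hZ, rfl⟩ := L.screen_smooth.exists_isSection_inf_perp g L.immersion.contMDiff
        hL.Bo_smooth (fun q ↦ L.Bo_le_screen) (hL.Bo_nondegenerate p) hz
      exact (inner_inducedStar_eq_iff hJ D hL hX hY hz).1 (h2 X Y Z hX hY hZ p)
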